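/- Let $k\ge 2$ be the size of the source alphabet $\mathcal X=\{1,\dots,k\}$, let $\varepsilon>0$, and let $\Delta_k$ be the set of probability vectors on $\mathcal X$. A mechanism is a conditional distribution $Q(\cdot\mid x)$, $x\in\mathcal X$, on some measurable space $\mathcal Y$; it is $\varepsilon$-locally differentially private if $Q(S\mid x)\le e^{\varepsilon}Q(S\mid x')$ for all $x,x'\in\mathcal X$ and all measurable $S\subseteq\mathcal Y$. For $p\in\Delta_k$ put $pQ=\sum_i p_iQ(\cdot\mid i)$. For $\ell_2^2(v,p)=\sum_i(v_i-p_i)^2$ and $\ell_1(v,p)=\sum_i|v_i-p_i|$, and for $\ell$ either of these losses, let $$r^{\ell}_{k,n}(Q)=\inf_{\hat p}\sup_{p\in\Delta_k}\mathbb E_{Y^n\sim(pQ)^n}\,\ell(\hat p(Y^n),p),\qquad r^{\ell}_{\varepsilon,k,n}=\inf_{Q}r^{\ell}_{k,n}(Q),$$ where $\hat p$ ranges over the measurable maps $\mathcal Y^n\to\mathbb R^k$ and $Q$ over all $\varepsilon$-locally differentially private mechanisms (with arbitrary output space). For $1\le d\le k-1$ let $\mathcal Y_{k,d}=\{y\in\{0,1\}^k:\sum_i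 y_i=d\}$ and $$Q_{k,d}(y\mid i)=\frac{e^{\varepsilon}y_i+1-y_i}{\binom{k-1}{d-1}e^{\varepsilon}+\binom{k-1}{d}},\qquad \hat p^{\mathrm{emp}}_i(y^{(1)},\dots,y^{(n)})=\frac{(k-1)e^{\varepsilon}+\frac{(k-1)(k-d)}{d}}{(k-d)(e^{\varepsilon}-1)}\cdot\frac{1}{n}\sum_{j=1}^n y^{(j)}_i-\frac{(d-1)e^{\varepsilon}+k-d}{(k-d)(e^{\varepsilon}-1)}.$$ **Theorem.** For every $A>0$ there are constants $c,C>0$, depending only on $A$, such that for all integers $k\ge2$ and all $\varepsilon>0$ with $e^{\varepsilon}\le Ak$ the following holds with $d=\lceil k/(e^{\varepsilon}+1)\rceil$. The mechanism $Q_{k,d}$ is $\varepsilon$-locally differentially private, and there is $N=N(k,\varepsilon)$ such that for all $n\ge N$ $$c\,\frac{k e^{\varepsilon}}{n(e^{\varepsilon}-1)^2}\le r^{\ell_2^2}_{\varepsilon,k,n}\le r^{\ell_2^2}_{k,n}(Q_{k,d})\le\sup_{p\in\Delta_k}\mathbb E_{Y^n\sim(pQ_{k,d})^n}\,\ell_2^2(\hat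 p^{\mathrm{emp}}(Y^n),p)\le C\,\frac{k e^{\varepsilon}}{n(e^{\varepsilon}-1)^2},$$ $$c\,\frac{k\sqrt{e^{\varepsilon}}}{(e^{\varepsilon}-1)\sqrt n}\le r^{\ell_1}_{\varepsilon,k,n}\le r^{\ell_1}_{k,n}(Q_{k,d})\le\sup_{p\in\Delta_k}\mathbb E_{Y^n\sim(pQ_{k,d})^n}\,\ell_1(\hat p^{\mathrm{emp}}(Y^n),p)\le C\,\frac{k\sqrt{e^{\varepsilon}}}{(e^{\varepsilon}-1)\sqrt n}.$$ In particular both private minimax risks have the stated orders in the regime $e^{\varepsilon}\ll k$ for $n$ large, and the schemes $Q_{k,\lceil k/(e^{\varepsilon}+1)\rceil}$, with their empirical estimators, are order optimal there. -/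

import Mathlib

open MeasureTheory ProbabilityTheory

universe u

namespace LDPEstimation

/-- A loss function on `ℝ^k`: `ℓ v p` is the loss of the estimate `v` when the truth is `p`. -/
abbrev Loss (k : ℕ) := (Fin k → ℝ) → (Fin k → ℝ) → ℝ

/-- The squared Euclidean loss `ℓ₂²(v, p) = ∑ i, (v i - p i)²`. -/
def lossL2Sq (k : ℕ) : Loss k := fun v p => ∑ i, (v i - p i) ^ 2

/-- The loss `ℓ₁(v, p) = ∑ i, |v i - p i|`. -/
def lossL1 (k : ℕ) : Loss k := fun v p => ∑ i, |v i - p i|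

section Risk

variable {k : ℕ} {Y : Type u} [MeasurableSpace Y]

/-- `Q` is an `ε`-locally differentially private mechanism: a conditional distribution
`Q(· | x)`, `x ∈ {1, …, k}`, on `Y` with `Q(S | x) ≤ e^ε Q(S | x')` for all inputs `x`, `x'` and
all measurable `S`. -/
def IsLDP (ε : ℝ) (Q : Kernel (Fin k) Y) : Prop :=
  IsMarkovKernel Q ∧
    ∀ (x x' : Fin k) (S : Set Y), MeasurableSet S →
      Q x S ≤ ENNReal.ofReal (Real.exp ε) * Q x' S

/-- The distribution `m = pQ` of a privatized sample, `m(S) = ∑ i, p i * Q(S | i)`. -/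
noncomputable def marginal (Q : Kernel (Fin k) Y) (p : Fin k → ℝ) : Measure Y :=
  ∑ i, ENNReal.ofReal (p i) • Q i

/-- The risk `E ℓ(phat(Y^n), p)`, where `Y^n` consists of `n` i.i.d. samples of `pQ`. -/
noncomputable def risk (n : ℕ) (ℓ : Loss k) (Q : Kernel (Fin k) Y)
    (phat : (Fin n → Y) → (Fin k → ℝ)) (p : Fin k → ℝ) : ENNReal :=
  ∫⁻ y, ENNReal.ofReal (ℓ (phat y) p) ∂(Measure.pi fun _ : Fin n => marginal Q p)

/-- The worst-case risk of an estimator over the probability simplex `Δ_k`. -/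
noncomputable def worstCaseRisk (n : ℕ) (ℓ : Loss k) (Q : Kernel (Fin k) Y)
    (phat : (Fin n → Y) → (Fin k → ℝ)) : ENNReal :=
  ⨆ p ∈ stdSimplex ℝ (Fin k), risk n ℓ Q phat p

/-- The minimax risk of the mechanism `Q`: infimum of the worst-case risk over all measurable
estimators. -/
noncomputable def minimaxRisk (n : ℕ) (ℓ : Loss k) (Q : Kernel (Fin k) Y) : ENNReal :=
  ⨅ (phat : (Fin n → Y) → (Fin k → ℝ)) (_ : Measurable phat), worstCaseRisk n ℓ Q phat

end Risk

/-- The `ε`-private minimax risk: infimum of the minimax risk over all `ε`-locally differentially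
private mechanisms with an arbitrary measurable output space. -/
noncomputable def privateMinimaxRisk (ε : ℝ) (k n : ℕ) (ℓ : Loss k) : ENNReal :=
  ⨅ (Y : Type u) (_ : MeasurableSpace Y) (Q : Kernel (Fin k) Y) (_ : IsLDP ε Q),
    minimaxRisk n ℓ Q

/-- The output alphabet `{y ∈ {0,1}^k : ∑ i, y i = d}`; a binary vector `y` is represented by its
support `{i : y i = 1}`, a `d`-element subset of `Fin k`. -/
def SubsetAlphabet (k d : ℕ) : Type := {y : Finset (Fin k) // y.card = d}

instance (k d : ℕ) : Fintype (SubsetAlphabet k d) :=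
  inferInstanceAs (Fintype {y : Finset (Fin k) // y.card = d})

instance (k d : ℕ) : MeasurableSpace (SubsetAlphabet k d) := ⊤

/-- The probability `Q_{k,d}(y | i)`. -/
noncomputable def subsetProb (k d : ℕ) (ε : ℝ) (i : Fin k) (y : SubsetAlphabet k d) : ℝ :=
  (if i ∈ y.1 then Real.exp ε else 1) /
    (((k - 1).choose (d - 1) : ℝ) * Real.exp ε + ((k - 1).choose d : ℝ))

/-- The scheme `Q_{k,d}` (for `1 ≤ d ≤ k - 1`). -/
noncomputable def subsetScheme (k d : ℕ) (ε : ℝ) : Kernel (Fin k) (SubsetAlphabet k d) :=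
  Kernel.ofFunOfCountable fun i =>
    ∑ y, ENNReal.ofReal (subsetProb k d ε i y) • Measure.dirac y

/-- `T_i`, the number of the `n` samples whose `i`-th coordinate is `1`. -/
def count {k d n : ℕ} (y : Fin n → SubsetAlphabet k d) (i : Fin k) : ℕ :=
  (Finset.univ.filter fun j => i ∈ (y j).1).card

/-- The empirical estimator for the scheme `Q_{k,d}`. -/
noncomputable def empiricalEstimator (k d n : ℕ) (ε : ℝ) :
    (Fin n → SubsetAlphabet k d) → (Fin k → ℝ) := fun y i =>
  (((k : ℝ) - 1) * Real.exp ε + ((k : ℝ) - 1) * ((k : ℝ) - d) / d) /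
      (((k : ℝ) - d) * (Real.exp ε - 1)) * ((count y i : ℝ) / n)
    - (((d : ℝ) - 1) * Real.exp ε + k - d) / (((k : ℝ) - d) * (Real.exp ε - 1))

/-- The parameter `d = ⌈k / (e^ε + 1)⌉`. -/
noncomputable def subsetSize (k : ℕ) (ε : ℝ) : ℕ := ⌈(k : ℝ) / (Real.exp ε + 1)⌉₊

/-- The order `k e^ε / (n (e^ε - 1)²)`. -/
noncomputable def rateL2Sq (ε : ℝ) (k n : ℕ) : ℝ :=
  k * Real.exp ε / (n * (Real.exp ε - 1) ^ 2)

/-- The order `k √(e^ε) / ((e^ε - 1) √n)`. -/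
noncomputable def rateL1 (ε : ℝ) (k n : ℕ) : ℝ :=
  k * Real.sqrt (Real.exp ε) / ((Real.exp ε - 1) * Real.sqrt n)

end LDPEstimation

namespace LDPEstimation

/-! ### Product densities and the affinity bound -/

/-! Lower bound: Assouad's method on the hypercube of distributions that shift mass `δ` inside
disjoint pairs of symbols, around the uniform distribution. A private mechanism has densities `q i`
with respect to the average `μ` of its rows; at each output they sum to `k` and have ratios at most
`e^ε`. Flipping bit `j` changes the density of a sample by `2δ` times the difference of `q` over the
`j`-th pair. By `sum_sq_sub_le` the squares of these differences, summed over all pairs, are at most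
`k (e^ε - 1)² / e^ε`, whatever the mechanism. So with `δ²` of order `e^ε / (n (e^ε - 1)²)` the
`n`-fold products at neighbouring vertices still overlap on average over `j`
(`le_integral_min_prod`), and `IsLDP.le_worstCaseRisk` charges a constant fraction of the pairs.
Large `n` is needed only to keep `δ ≤ 1 / (2k)`.

Upper bound: the empirical estimator is unbiased and affine in the counts, and every output has
exactly `d` ones, so its squared risk is at most `empSlope² d / n`. For the chosen `d` the slope is
at most `4 e^ε / (e^ε - 1)` and `d e^ε ≤ (1 + A) k` (`empSlope_sq_mul_subsetSize_le`). The `ℓ₁`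
bound follows from the squared one by Young's inequality with a balanced weight. -/

theorem pi_withDensity_ofReal {Y : Type*} [MeasurableSpace Y] (n : ℕ) (μ : Measure Y)
    [IsProbabilityMeasure μ] {f : Y → ℝ} (hf0 : ∀ y, 0 ≤ f y) (hfi : Integrable f μ) :
    Measure.pi (fun _ : Fin n => μ.withDensity fun y => ENNReal.ofReal (f y)) =
      (Measure.pi fun _ : Fin n => μ).withDensity
        fun y => ENNReal.ofReal (∏ j, f (y j)) := by
  have : IsFiniteMeasure (μ.withDensity fun y => ENNReal.ofReal (f y)) :=
    isFiniteMeasure_withDensity_ofReal hfi.2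
  refine Measure.pi_eq fun s hs => ?_
  rw [withDensity_apply _ (MeasurableSet.univ_pi hs), Measure.restrict_pi_pi,
    ← ofReal_integral_eq_lintegral_ofReal, integral_fintype_prod_eq_prod (fun _ => f),
    ENNReal.ofReal_prod_of_nonneg]
  · refine Finset.prod_congr rfl fun i _ => ?_
    rw [withDensity_apply _ (hs i), ← ofReal_integral_eq_lintegral_ofReal hfi.integrableOn
      (ae_of_all _ hf0)]
  · exact fun i _ => integral_nonneg hf0
  · exact Integrable.fintype_prod (f := fun _ => f) fun i => hfi.integrableOn
  · exact ae_of_all _ fun y => Finset.prod_nonneg fun j _ => hf0 _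

/-- For `a ≤ b` the right side is `a + b / 4`, so this is AM-GM. It is linear in the overlap and
therefore turns a Hellinger affinity directly into a lower bound on the integral of the minimum. -/
theorem sqrt_mul_le_min_add {a b : ℝ} (ha : 0 ≤ a) (hb : 0 ≤ b) :
    √(a * b) ≤ 3 / 4 * min a b + (a + b) / 4 := by
  wlog h : a ≤ b generalizing a b
  · rw [mul_comm, min_comm, add_comm a b]
    exact this hb ha (le_of_not_ge h)
  rw [min_eq_left h]
  refine Real.sqrt_le_iff.2 ⟨by positivity, ?_⟩
  nlinarith [sq_nonneg (a - b / 4)]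

/-- With `a = x²` and `b = y²` the gap between the means is `(x - y)² / 2`, while `(a - b)² = (x -
y)² (x + y)²` and `(x + y)² ≥ 2`. Integrated, it bounds the Hellinger distance by the squared `L²`
distance. -/
theorem half_add_le_sqrt_mul_add {a b : ℝ} (ha : 1 / 2 ≤ a) (hb : 1 / 2 ≤ b) :
    (a + b) / 2 ≤ √(a * b) + (a - b) ^ 2 / 4 := by
  have ha0 : 0 ≤ a := by linarith
  have hb0 : 0 ≤ b := by linarith
  obtain ⟨x, hx, rfl⟩ : ∃ x, 0 ≤ x ∧ a = x ^ 2 := ⟨√a, Real.sqrt_nonneg _, (Real.sq_sqrt ha0).symm⟩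
  obtain ⟨y, hy, rfl⟩ : ∃ x, 0 ≤ x ∧ b = x ^ 2 := ⟨√b, Real.sqrt_nonneg _, (Real.sq_sqrt hb0).symm⟩
  rw [← mul_pow, Real.sqrt_sq (by positivity)]
  have hxy : 1 / 2 ≤ x * y := by
    by_contra! h
    nlinarith [mul_nonneg hx hy, mul_le_mul ha hb (by norm_num) ha0]
  have h2 : 2 ≤ (x + y) ^ 2 := by nlinarith
  nlinarith [mul_le_mul_of_nonneg_left h2 (sq_nonneg (x - y))]

/-- Two product densities with close factors overlap. -/
theorem le_integral_min_prod {Y : Type*} [MeasurableSpace Y] (n : ℕ) (μ : Measure Y)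
    [IsProbabilityMeasure μ] {f g : Y → ℝ} {K : ℝ} (hfm : Measurable f) (hgm : Measurable g)
    (hf : ∀ y, 1 / 2 ≤ f y) (hg : ∀ y, 1 / 2 ≤ g y) (hfK : ∀ y, f y ≤ K) (hgK : ∀ y, g y ≤ K)
    (hf1 : ∫ y, f y ∂μ = 1) (hg1 : ∫ y, g y ∂μ = 1) :
    2 / 3 - n / 3 * ∫ y, (f y - g y) ^ 2 ∂μ ≤
      ∫ y, min (∏ j, f (y j)) (∏ j, g (y j)) ∂(Measure.pi fun _ : Fin n => μ) := by
  have hf0 : ∀ y, 0 ≤ f y := fun y => by linarith [hf y]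
  have hg0 : ∀ y, 0 ≤ g y := fun y => by linarith [hg y]
  have hfi : Integrable f μ := Integrable.of_bound hfm.aestronglyMeasurable K
    (ae_of_all _ fun y => by rw [Real.norm_of_nonneg (hf0 y)]; exact hfK y)
  have hgi : Integrable g μ := Integrable.of_bound hgm.aestronglyMeasurable K
    (ae_of_all _ fun y => by rw [Real.norm_of_nonneg (hg0 y)]; exact hgK y)
  have hsi : Integrable (fun y => √(f y * g y)) μ :=
    Integrable.of_bound (by fun_prop) (√(K * K)) (ae_of_all _ fun y => by
      rw [Real.norm_of_nonneg (Real.sqrt_nonneg _)]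
      exact Real.sqrt_le_sqrt (mul_le_mul (hfK y) (hgK y) (hg0 y) ((hf0 y).trans (hfK y))))
  have hdi : Integrable (fun y => (f y - g y) ^ 2) μ :=
    Integrable.of_bound (by fun_prop) (K ^ 2) (ae_of_all _ fun y => by
      rw [Real.norm_of_nonneg (sq_nonneg _), ← sq_abs]
      have : |f y - g y| ≤ K := abs_le.2
        ⟨by linarith [hf0 y, hgK y], by linarith [hg0 y, hfK y]⟩
      gcongr)
  set ρ := ∫ y, √(f y * g y) ∂μ with hρ
  have h1 : 1 ≤ ρ + (∫ y, (f y - g y) ^ 2 ∂μ) / 4 := by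
    have := integral_mono (μ := μ) ((hfi.add hgi).div_const 2) (hsi.add (hdi.div_const 4))
      fun y => half_add_le_sqrt_mul_add (hf y) (hg y)
    simp only [Pi.add_apply] at this
    rw [integral_div, integral_add hfi hgi, integral_add hsi (hdi.div_const 4), integral_div,
      hf1, hg1] at this
    linarith
  have hρ0 : 0 ≤ ρ := integral_nonneg fun y => Real.sqrt_nonneg _
  -- The affinity of the `n`-fold products is `ρ ^ n`; Bernoulli's inequality makes the loss linear
  -- in `n`.
  have hbern : 1 + n * (ρ - 1) ≤ ρ ^ n := by
    have := one_add_mul_le_pow (a := ρ - 1) (by linarith) n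
    simpa using this
  have hFi : Integrable (fun y : Fin n → Y => ∏ j, f (y j)) (Measure.pi fun _ => μ) :=
    Integrable.fintype_prod (f := fun _ => f) fun _ => hfi
  have hGi : Integrable (fun y : Fin n → Y => ∏ j, g (y j)) (Measure.pi fun _ => μ) :=
    Integrable.fintype_prod (f := fun _ => g) fun _ => hgi
  have hSi : Integrable (fun y : Fin n → Y => ∏ j, √(f (y j) * g (y j))) (Measure.pi fun _ => μ) :=
    Integrable.fintype_prod (f := fun _ y => √(f y * g y)) fun _ => hsi
  have h2 := integral_mono hSi (((hFi.inf hGi).const_mul (3 / 4)).add ((hFi.add hGi).div_const 4))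
    fun y => by
      show ∏ j, √(f (y j) * g (y j)) ≤ 3 / 4 * min (∏ j, f (y j)) (∏ j, g (y j)) +
        (∏ j, f (y j) + ∏ j, g (y j)) / 4
      rw [← Real.sqrt_prod _ fun i _ => mul_nonneg (hf0 _) (hg0 _), Finset.prod_mul_distrib]
      exact sqrt_mul_le_min_add (Finset.prod_nonneg fun _ _ => hf0 _)
        (Finset.prod_nonneg fun _ _ => hg0 _)
  rw [integral_fintype_prod_eq_pow (fun y => √(f y * g y)), integral_add' ((hFi.inf hGi).const_mul _)
    ((hFi.add hGi).div_const 4), integral_const_mul, integral_div, integral_add' hFi hGi,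
    integral_fintype_prod_eq_pow f, integral_fintype_prod_eq_pow g, hf1, hg1] at h2
  simp only [Fintype.card_fin, one_pow, Pi.inf_apply, ← hρ] at h2
  have h3 : (n : ℝ) * (1 - (∫ y, (f y - g y) ^ 2 ∂μ) / 4 - 1) ≤ n * (ρ - 1) := by
    gcongr; linarith
  linarith

/-! ### Densities of a locally private mechanism -/

/-- The average `μ` of the rows dominates each of them. Privacy on all measurable sets passes to the
Radon-Nikodym derivatives almost everywhere. -/
theorem IsLDP.exists_density {k : ℕ} {Y : Type*} [MeasurableSpace Y] {ε : ℝ}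
    {Q : Kernel (Fin k) Y} (hk : 0 < k) (hε : 0 ≤ ε) (hQ : IsLDP ε Q) :
    ∃ (μ : Measure Y) (q : Fin k → Y → ℝ), IsProbabilityMeasure μ ∧ (∀ i, Measurable (q i)) ∧
      (∀ i y, 0 ≤ q i y) ∧ (∀ i j y, q i y ≤ Real.exp ε * q j y) ∧ (∀ y, ∑ i, q i y = k) ∧
      ∀ i, Q i = μ.withDensity fun y => ENNReal.ofReal (q i y) := by
  classical
  have := hQ.1
  have hk0 : (k : ENNReal) ≠ 0 := by exact_mod_cast hk.ne'
  have hkt : (k : ENNReal) ≠ ⊤ := ENNReal.natCast_ne_top k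
  set μ : Measure Y := (k : ENNReal)⁻¹ • ∑ i, Q i with hμ
  have hμs : ∀ s, (k : ENNReal) * μ s = ∑ i, Q i s := fun s => by
    rw [hμ, Measure.smul_apply, smul_eq_mul, ← mul_assoc, ENNReal.mul_inv_cancel hk0 hkt, one_mul,
      Measure.finsetSum_apply]
  have hμp : IsProbabilityMeasure μ := ⟨by
    have := hμs Set.univ
    simp only [measure_univ, Finset.sum_const, Finset.card_univ, Fintype.card_fin, nsmul_eq_mul,
      mul_one] at this
    conv_rhs at this => rw [← mul_one (k : ENNReal)]
    exact (ENNReal.mul_right_inj hk0 hkt).1 this⟩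
  have hac : ∀ i, Q i ≪ μ := fun i s hs => by
    have h := hμs s
    rw [hs, mul_zero] at h
    exact Finset.sum_eq_zero_iff.1 h.symm i (Finset.mem_univ i)
  set r : Fin k → Y → ENNReal := fun i => (Q i).rnDeriv μ with hr
  have hrm : ∀ i, Measurable (r i) := fun i => Measure.measurable_rnDeriv _ _
  have hrQ : ∀ i, μ.withDensity (r i) = Q i := fun i => Measure.withDensity_rnDeriv_eq _ _ (hac i)
  have hrs : ∀ i s, MeasurableSet s → ∫⁻ y in s, r i y ∂μ = Q i s := fun i s hs => by
    rw [← withDensity_apply _ hs, hrQ]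
  have h1 : ∀ i j, ∀ᵐ y ∂μ, r i y ≤ ENNReal.ofReal (Real.exp ε) * r j y := fun i j => by
    refine ae_le_of_forall_setLIntegral_le_of_sigmaFinite (hrm i) fun s hs _ => ?_
    rw [lintegral_const_mul _ (hrm j), hrs i s hs, hrs j s hs]
    exact hQ.2 i j s hs
  have h2 : ∀ᵐ y ∂μ, ∑ i, r i y = k := by
    refine ae_eq_of_forall_setLIntegral_eq_of_sigmaFinite
      (Finset.measurable_sum _ fun i _ => hrm i) measurable_const fun s hs _ => ?_
    rw [lintegral_finsetSum _ fun i _ => hrm i, setLIntegral_const, hμs]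
    exact Finset.sum_congr rfl fun i _ => hrs i s hs
  set G : Set Y := {y | (∀ i j, r i y ≤ ENNReal.ofReal (Real.exp ε) * r j y) ∧ ∑ i, r i y = k}
    with hG
  have hGm : MeasurableSet G := by
    refine MeasurableSet.inter (s₁ := {y | ∀ i j, r i y ≤ ENNReal.ofReal (Real.exp ε) * r j y})
      (s₂ := {y | ∑ i, r i y = k}) ?_ ?_
    · simp only [Set.ofPred_forall]
      exact MeasurableSet.iInter fun i => MeasurableSet.iInter fun j =>
        measurableSet_le (hrm i) ((hrm j).const_mul _)
    · exact measurableSet_eq_fun (Finset.measurable_sum _ fun i _ => hrm i) measurable_const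
  have hGae : ∀ᵐ y ∂μ, y ∈ G := by
    filter_upwards [ae_all_iff.2 fun i => ae_all_iff.2 fun j => h1 i j, h2] with y hy hy'
    exact ⟨hy, hy'⟩
  have hfin : ∀ y ∈ G, ∀ i, r i y ≠ ⊤ := fun y hy i => by
    refine ne_top_of_le_ne_top hkt ?_
    rw [← hy.2]
    exact Finset.single_le_sum (f := fun i => r i y) (fun _ _ => zero_le) (Finset.mem_univ i)
  -- Off the good set `G`, which has full measure, all densities are set to `1`; this satisfies the
  -- constraints too, so they hold at every point.
  refine ⟨μ, fun i y => if y ∈ G then (r i y).toReal else 1, hμp, fun i => ?_, fun i y => ?_,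
    fun i j y => ?_, fun y => ?_, fun i => ?_⟩
  · exact Measurable.ite hGm (hrm i).ennreal_toReal measurable_const
  · dsimp only
    split_ifs <;> positivity
  · by_cases hy : y ∈ G
    · simp only [hy, if_true]
      have := ENNReal.toReal_mono (ENNReal.mul_ne_top ENNReal.ofReal_ne_top (hfin y hy j)) (hy.1 i j)
      rwa [ENNReal.toReal_mul, ENNReal.toReal_ofReal (Real.exp_pos _).le] at this
    · simp only [hy, if_false, mul_one]
      exact Real.one_le_exp hε
  · by_cases hy : y ∈ G
    · simp only [hy, if_true]
      rw [← ENNReal.toReal_sum fun i _ => hfin y hy i, hy.2, ENNReal.toReal_natCast]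
    · simp [hy]
  · conv_lhs => rw [← hrQ i]
    refine withDensity_congr_ae ?_
    filter_upwards [hGae] with y hy
    simp only [hy, if_true]
    rw [ENNReal.ofReal_toReal (hfin y hy i)]

theorem marginal_eq_withDensity {k : ℕ} {Y : Type*} [MeasurableSpace Y] {Q : Kernel (Fin k) Y}
    {μ : Measure Y} {q : Fin k → Y → ℝ} (hqm : ∀ i, Measurable (q i)) (hq0 : ∀ i y, 0 ≤ q i y)
    (hqQ : ∀ i, Q i = μ.withDensity fun y => ENNReal.ofReal (q i y)) {p : Fin k → ℝ}
    (hp : ∀ i, 0 ≤ p i) :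
    marginal Q p = μ.withDensity fun y => ENNReal.ofReal (∑ i, p i * q i y) := by
  ext s hs
  rw [marginal, Measure.finsetSum_apply, withDensity_apply _ hs]
  simp_rw [ENNReal.ofReal_sum_of_nonneg fun i _ => mul_nonneg (hp i) (hq0 i _),
    ENNReal.ofReal_mul (hp _)]
  rw [lintegral_finsetSum _ fun i _ => ((hqm i).ennreal_ofReal).const_mul _]
  refine Finset.sum_congr rfl fun i _ => ?_
  rw [Measure.smul_apply, hqQ, withDensity_apply _ hs,
    lintegral_const_mul _ (hqm i).ennreal_ofReal, smul_eq_mul]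

/-- The contraction inequality behind the private lower bounds. -/
theorem sum_sq_sub_le {k m : ℕ} (hk : 0 < k) {x : Fin k → ℝ} {t : ℝ} (ht : 0 < t)
    (hx0 : ∀ i, 0 ≤ x i) (hx : ∀ i j, x i ≤ t * x j) (hsum : ∑ i, x i = k)
    (e : Fin m × Bool ↪ Fin k) :
    ∑ j, (x (e (j, true)) - x (e (j, false))) ^ 2 ≤ k * (t - 1) ^ 2 / t := by
  have : Nonempty (Fin k) := ⟨⟨0, hk⟩⟩
  obtain ⟨i₀, hi₀⟩ := Finite.exists_min x
  set a := x i₀ with ha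
  have hk' : (0 : ℝ) < k := by exact_mod_cast hk
  have ha1 : a ≤ 1 := by
    have : ∑ _i : Fin k, a ≤ ∑ i, x i := Finset.sum_le_sum fun i _ => hi₀ i
    rw [hsum, Finset.sum_const, Finset.card_univ, Fintype.card_fin, nsmul_eq_mul] at this
    nlinarith
  have hta : 1 ≤ t * a := by
    have : ∑ i, x i ≤ ∑ _i : Fin k, t * a := Finset.sum_le_sum fun i _ => hx i i₀
    rw [hsum, Finset.sum_const, Finset.card_univ, Fintype.card_fin, nsmul_eq_mul] at this
    nlinarith
  have ht1 : 0 ≤ t - 1 := by nlinarith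
  -- One factor `|x u - x v|` is bounded by the range `a (t - 1)`, the other by the total excess
  -- over the minimum `a`; the excesses sum to at most `k (1 - a)`.
  have hterm : ∀ u v, (x u - x v) ^ 2 ≤ a * (t - 1) * ((x u - a) + (x v - a)) := fun u v => by
    have h1 := hx u i₀
    have h2 := hx v i₀
    have h3 := hi₀ u
    have h4 := hi₀ v
    rw [← sq_abs, sq]
    refine mul_le_mul ?_ ?_ (abs_nonneg _) (mul_nonneg (hx0 i₀) ht1)
    · exact abs_le.2 ⟨by linarith, by linarith⟩
    · exact abs_le.2 ⟨by linarith, by linarith⟩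
  have hpair : ∑ j, ((x (e (j, true)) - a) + (x (e (j, false)) - a)) ≤ k * (1 - a) := by
    calc ∑ j, ((x (e (j, true)) - a) + (x (e (j, false)) - a))
        = ∑ z, (x (e z) - a) := by
          rw [Fintype.sum_prod_type]
          exact Finset.sum_congr rfl fun j _ => by rw [Fintype.sum_bool]
      _ = ∑ i ∈ Finset.univ.map e, (x i - a) := by rw [Finset.sum_map]
      _ ≤ ∑ i, (x i - a) := Finset.sum_le_sum_of_subset_of_nonneg (Finset.subset_univ _)
          fun i _ _ => sub_nonneg.2 (hi₀ i)
      _ = k * (1 - a) := by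
          rw [Finset.sum_sub_distrib, hsum, Finset.sum_const, Finset.card_univ, Fintype.card_fin,
            nsmul_eq_mul]; ring
  calc ∑ j, (x (e (j, true)) - x (e (j, false))) ^ 2
      ≤ ∑ j, a * (t - 1) * ((x (e (j, true)) - a) + (x (e (j, false)) - a)) :=
        Finset.sum_le_sum fun j _ => hterm _ _
    _ = a * (t - 1) * ∑ j, ((x (e (j, true)) - a) + (x (e (j, false)) - a)) := by
        rw [Finset.mul_sum]
    _ ≤ a * (t - 1) * (k * (1 - a)) :=
        mul_le_mul_of_nonneg_left hpair (mul_nonneg (hx0 i₀) ht1)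
    _ ≤ k * (t - 1) ^ 2 / t := by
        rw [le_div_iff₀ ht]
        -- Indeed `t - 1 - t a (1 - a) = t (1 - a)² + (t a - 1)`, and both terms are nonnegative.
        have : a * (1 - a) * t ≤ t - 1 := by
          have h1 : 0 ≤ (1 - a) * (t * (1 - a)) :=
            mul_nonneg (by linarith) (mul_nonneg ht.le (by linarith))
          nlinarith
        calc a * (t - 1) * (k * (1 - a)) * t = k * (t - 1) * (a * (1 - a) * t) := by ring
          _ ≤ k * (t - 1) * (t - 1) := mul_le_mul_of_nonneg_left this (by positivity)
          _ = k * (t - 1) ^ 2 := by ring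

/-! ### Assouad's method -/

/-- The hypercube vertex obtained by flipping the `j`-th bit. -/
def flipBit {m : ℕ} (j : Fin m) (ν : Fin m → Bool) : Fin m → Bool :=
  Function.update ν j (!ν j)

theorem flipBit_involutive {m : ℕ} (j : Fin m) : Function.Involutive (flipBit j) := fun ν => by
  simp [flipBit]

/-- Average over all vertices: flipping a bit permutes the hypercube, so both halves of the lower
bound have the same sum. -/
theorem assouad_average {m : ℕ} {R : (Fin m → Bool) → Fin m → ENNReal} {W B : ENNReal}
    (hR : ∀ ν, ∑ j, R ν j ≤ W) (hB : ∀ ν, B ≤ ∑ j, (R ν j + R (flipBit j ν) j)) :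
    B ≤ 2 * W := by
  have hflip : ∑ ν, ∑ j, R (flipBit j ν) j = ∑ ν, ∑ j, R ν j := by
    rw [Finset.sum_comm, Finset.sum_comm (f := fun ν j => R ν j)]
    exact Finset.sum_congr rfl fun j _ =>
      Equiv.sum_comp (flipBit_involutive j).toPerm fun ν => R ν j
  have h : ∑ _ν : Fin m → Bool, B ≤ ∑ _ν : Fin m → Bool, 2 * W := by
    calc ∑ _ν : Fin m → Bool, B ≤ ∑ ν, ∑ j, (R ν j + R (flipBit j ν) j) :=
          Finset.sum_le_sum fun ν _ => hB ν
      _ = 2 * ∑ ν, ∑ j, R ν j := by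
          simp_rw [Finset.sum_add_distrib]
          rw [hflip, two_mul]
      _ ≤ 2 * ∑ _ν : Fin m → Bool, W := by
          gcongr with ν _
          exact hR ν
      _ = _ := by rw [Finset.mul_sum]
  rw [Finset.sum_const, Finset.sum_const, nsmul_eq_mul, nsmul_eq_mul] at h
  exact (ENNReal.mul_le_mul_iff_right (by simp) (ENNReal.natCast_ne_top _)).1 h

/-- The sign `±1` of a bit. -/
def bitSign (b : Bool) : ℝ := if b then 1 else -1

theorem bitSign_not (b : Bool) : bitSign (!b) = -bitSign b := by cases b <;> simp [bitSign]

theorem abs_bitSign (b : Bool) : |bitSign b| = 1 := by cases b <;> simp [bitSign]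

/-- The perturbation of the uniform distribution indexed by a vertex of the hypercube. -/
noncomputable def perturbation {k m : ℕ} (e : Fin m × Bool ↪ Fin k) (δ : ℝ) (ν : Fin m → Bool)
    (i : Fin k) : ℝ :=
  1 / k + δ * ∑ z : Fin m × Bool, if e z = i then bitSign (ν z.1) * bitSign z.2 else 0

section Perturbation

variable {k m : ℕ} (e : Fin m × Bool ↪ Fin k) (δ : ℝ) (ν : Fin m → Bool)

theorem perturbation_apply (z : Fin m × Bool) :
    perturbation e δ ν (e z) = 1 / k + δ * (bitSign (ν z.1) * bitSign z.2) := by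
  rw [perturbation, Finset.sum_eq_single z]
  · simp
  · intro w _ hw
    rw [if_neg fun h => hw (e.injective h)]
  · simp

theorem abs_perturbation_sub_le (hδ : 0 ≤ δ) (i : Fin k) :
    |perturbation e δ ν i - 1 / k| ≤ δ := by
  by_cases hi : ∃ z, e z = i
  · obtain ⟨z, rfl⟩ := hi
    rw [perturbation_apply, add_sub_cancel_left, abs_mul, abs_mul, abs_bitSign, abs_bitSign,
      abs_of_nonneg hδ]
    simp
  · rw [perturbation, Finset.sum_eq_zero fun z _ => if_neg fun h => hi ⟨z, h⟩]
    simpa using hδ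

/-- Applied to the densities at an output, this gives the density of a sample as an affine function
of the signs; applied to `x = 1`, it gives the total mass. -/
theorem sum_perturbation_mul (hk : 0 < k) {x : Fin k → ℝ} (hx : ∑ i, x i = k) :
    ∑ i, perturbation e δ ν i * x i =
      1 + δ * ∑ j, bitSign (ν j) * (x (e (j, true)) - x (e (j, false))) := by
  have hk' : (k : ℝ) ≠ 0 := by exact_mod_cast hk.ne'
  simp_rw [perturbation, add_mul, Finset.sum_add_distrib, ← Finset.mul_sum, hx]
  rw [one_div_mul_cancel hk']
  congr 1
  simp_rw [mul_assoc, ← Finset.mul_sum, Finset.sum_mul]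
  rw [Finset.sum_comm, Fintype.sum_prod_type]
  congr 1
  refine Finset.sum_congr rfl fun j _ => ?_
  simp only [Fintype.sum_bool]
  simp only [ite_mul, zero_mul, Finset.sum_ite_eq, Finset.mem_univ, if_true, bitSign]
  cases ν j <;> simp <;> ring

theorem perturbation_mem_stdSimplex (hk : 0 < k) (hδ : 0 ≤ δ) (hkδ : δ ≤ 1 / k) :
    perturbation e δ ν ∈ stdSimplex ℝ (Fin k) := by
  refine ⟨fun i => ?_, ?_⟩
  · linarith [(abs_le.1 (abs_perturbation_sub_le e δ ν hδ i)).1]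
  · simpa using sum_perturbation_mul e δ ν hk (x := fun _ => 1) (by simp)

theorem sum_perturbation_mul_sub_flipBit (hk : 0 < k) {x : Fin k → ℝ} (hx : ∑ i, x i = k)
    (j : Fin m) :
    ∑ i, perturbation e δ ν i * x i - ∑ i, perturbation e δ (flipBit j ν) i * x i =
      2 * δ * bitSign (ν j) * (x (e (j, true)) - x (e (j, false))) := by
  rw [sum_perturbation_mul e δ ν hk hx, sum_perturbation_mul e δ _ hk hx, add_sub_add_left_eq_sub,
    ← mul_sub, ← Finset.sum_sub_distrib, Finset.sum_eq_single j]
  · simp only [flipBit, Function.update_self, bitSign_not]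
    ring
  · intro i _ hi
    simp [flipBit, Function.update_of_ne hi]
  · simp

end Perturbation

theorem min_mul_le_add {a b x y t : ℝ} (ha : 0 ≤ a) (hb : 0 ≤ b) (hx : 0 ≤ x) (hy : 0 ≤ y)
    (h : t ≤ x + y) : min a b * t ≤ a * x + b * y := by
  have h0 : 0 ≤ min a b := le_min ha hb
  calc min a b * t ≤ min a b * (x + y) := by gcongr
    _ = min a b * x + min a b * y := mul_add _ _ _
    _ ≤ a * x + b * y := by
      gcongr
      · exact min_le_left _ _
      · exact min_le_right _ _

/-- Assouad's lower bound for a separable loss `∑ i, ψ (v i - p i)` under local privacy. -/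
theorem IsLDP.le_worstCaseRisk {k m n : ℕ} {Y : Type u} [MeasurableSpace Y] {ε δ τ : ℝ}
    {Q : Kernel (Fin k) Y} (hQ : IsLDP ε Q) (hε : 0 ≤ ε) (hk : 0 < k)
    (e : Fin m × Bool ↪ Fin k) (hm : k ≤ 3 * m) (hδ : 0 ≤ δ) (hkδ : δ ≤ 1 / (2 * k))
    (hnδ : 12 * n * δ ^ 2 * (Real.exp ε - 1) ^ 2 ≤ Real.exp ε) (hτ : 0 ≤ τ) {ψ : ℝ → ℝ}
    (hψ0 : ∀ x, 0 ≤ ψ x) (hψm : Measurable ψ) (hψ : ∀ x, 2 * τ ≤ ψ (x - δ) + ψ (x + δ))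
    {phat : (Fin n → Y) → Fin k → ℝ} (hphat : Measurable phat) :
    ENNReal.ofReal (τ * k / 9) ≤
      worstCaseRisk n (fun v p => ∑ i, ψ (v i - p i)) Q phat := by
  obtain ⟨μ, q, hμ, hqm, hq0, hqe, hqk, hqQ⟩ := hQ.exists_density hk hε
  have hk' : (0 : ℝ) < k := by exact_mod_cast hk
  have hkδ' : δ ≤ 1 / k := hkδ.trans (by gcongr; linarith)
  have hmem := fun ν => perturbation_mem_stdSimplex e δ ν hk hδ hkδ'
  set p := perturbation e δ with hp
  set f : (Fin m → Bool) → Y → ℝ := fun ν y => ∑ i, p ν i * q i y with hf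
  have hfm : ∀ ν, Measurable (f ν) := fun ν =>
    Finset.measurable_sum _ fun i _ => (hqm i).const_mul _
  have hp0 : ∀ ν i, 0 ≤ p ν i := fun ν => (hmem ν).1
  have hqle : ∀ i y, q i y ≤ k := fun i y => by
    rw [← hqk y]
    exact Finset.single_le_sum (f := fun i => q i y) (fun _ _ => hq0 _ _) (Finset.mem_univ i)
  have hfhalf : ∀ ν y, 1 / 2 ≤ f ν y := fun ν y => by
    have hpl : ∀ i, 1 / (2 * k) ≤ p ν i := fun i => by
      have h1 := (abs_le.1 (abs_perturbation_sub_le e δ ν hδ i)).1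
      have h2 : (1 : ℝ) / k = 1 / (2 * k) + 1 / (2 * k) := by field_simp; norm_num
      linarith
    calc (1 : ℝ) / 2 = ∑ i, 1 / (2 * k) * q i y := by
          rw [← Finset.mul_sum, hqk]; field_simp
      _ ≤ f ν y := Finset.sum_le_sum fun i _ => mul_le_mul_of_nonneg_right (hpl i) (hq0 i y)
  have hf0 : ∀ ν y, 0 ≤ f ν y := fun ν y => by linarith [hfhalf ν y]
  have hfK : ∀ ν y, f ν y ≤ k := fun ν y => by
    calc f ν y ≤ ∑ i, p ν i * k :=
          Finset.sum_le_sum fun i _ => mul_le_mul_of_nonneg_left (hqle i y) (hp0 ν i)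
      _ = k := by rw [← Finset.sum_mul, (hmem ν).2, one_mul]
  have hqi : ∀ i, Integrable (q i) μ := fun i =>
    Integrable.of_bound (hqm i).aestronglyMeasurable k
      (ae_of_all _ fun y => by rw [Real.norm_of_nonneg (hq0 i y)]; exact hqle i y)
  have hfi : ∀ ν, Integrable (f ν) μ := fun ν =>
    integrable_finsetSum _ fun i _ => (hqi i).const_mul _
  have hq1 : ∀ i, ∫ y, q i y ∂μ = 1 := fun i => by
    have := hQ.1
    have h := measure_univ (μ := Q i)
    rw [hqQ, withDensity_apply _ MeasurableSet.univ, Measure.restrict_univ,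
      ← ofReal_integral_eq_lintegral_ofReal (hqi i) (ae_of_all _ (hq0 i))] at h
    exact ENNReal.ofReal_eq_one.1 h
  have hf1 : ∀ ν, ∫ y, f ν y ∂μ = 1 := fun ν => by
    rw [hf, integral_finsetSum _ fun i _ => (hqi i).const_mul _]
    simp_rw [integral_const_mul, hq1, mul_one]
    exact (hmem ν).2
  set F : (Fin m → Bool) → (Fin n → Y) → ℝ := fun ν y => ∏ j, f ν (y j) with hF
  have hF0 : ∀ ν y, 0 ≤ F ν y := fun ν y => Finset.prod_nonneg fun _ _ => hf0 _ _
  have hFm : ∀ ν, Measurable (F ν) := fun ν =>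
    Finset.measurable_prod _ fun j _ => (hfm ν).comp (measurable_pi_apply j)
  have hFi : ∀ ν, Integrable (F ν) (Measure.pi fun _ => μ) := fun ν =>
    Integrable.fintype_prod (f := fun _ => f ν) fun _ => hfi ν
  -- Only the first coordinate of each pair is charged; dropping the others is harmless because `ψ`
  -- is nonnegative.
  set R : (Fin m → Bool) → Fin m → ENNReal := fun ν j =>
    ∫⁻ y, ENNReal.ofReal (F ν y * ψ (phat y (e (j, true)) - p ν (e (j, true))))
      ∂(Measure.pi fun _ => μ) with hR
  have hRm : ∀ ν j, Measurable fun y =>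
      ENNReal.ofReal (F ν y * ψ (phat y (e (j, true)) - p ν (e (j, true)))) := fun ν j =>
    ((hFm ν).mul (hψm.comp (((measurable_pi_apply _).comp hphat).sub_const _))).ennreal_ofReal
  have hRW : ∀ ν, ∑ j, R ν j ≤ worstCaseRisk n (fun v p => ∑ i, ψ (v i - p i)) Q phat :=
    fun ν => by
    refine le_trans ?_ (le_iSup₂ (f := fun p _ => risk n _ Q phat p) (p ν) (hmem ν))
    rw [risk, marginal_eq_withDensity hqm hq0 hqQ (hp0 ν),
      pi_withDensity_ofReal n μ (hf0 ν) (hfi ν),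
      lintegral_withDensity_eq_lintegral_mul₀ (hFm ν).ennreal_ofReal.aemeasurable,
      ← lintegral_finsetSum _ fun j _ => hRm ν j]
    · refine lintegral_mono fun y => ?_
      rw [Pi.mul_apply, ← ENNReal.ofReal_mul (hF0 ν y), ← ENNReal.ofReal_sum_of_nonneg
        fun j _ => mul_nonneg (hF0 ν y) (hψ0 _), ← Finset.mul_sum]
      refine ENNReal.ofReal_le_ofReal (mul_le_mul_of_nonneg_left ?_ (hF0 ν y))
      have hinj : Function.Injective fun j : Fin m => e (j, true) := fun a b h => by
        simpa using e.injective h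
      calc ∑ j, ψ (phat y (e (j, true)) - p ν (e (j, true)))
          = ∑ i ∈ Finset.univ.map ⟨_, hinj⟩, ψ (phat y i - p ν i) := by rw [Finset.sum_map]; rfl
        _ ≤ _ := Finset.sum_le_sum_of_subset_of_nonneg (Finset.subset_univ _) fun _ _ _ => hψ0 _
    · exact (Finset.measurable_sum _ fun i _ => hψm.comp
        (((measurable_pi_apply i).comp hphat).sub_const _)).ennreal_ofReal.aemeasurable
  set M : (Fin m → Bool) → Fin m → ℝ := fun ν j =>
    ∫ y, min (F ν y) (F (flipBit j ν) y) ∂(Measure.pi fun _ => μ) with hM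
  have hM0 : ∀ ν j, 0 ≤ M ν j := fun ν j => integral_nonneg fun y => le_min (hF0 _ _) (hF0 _ _)
  have hRM : ∀ ν j, ENNReal.ofReal (M ν j * (2 * τ)) ≤ R ν j + R (flipBit j ν) j := fun ν j => by
    rw [hR, hM]
    dsimp only
    have hmi : Integrable (fun y => min (F ν y) (F (flipBit j ν) y)) (Measure.pi fun _ => μ) :=
      (hFi ν).inf (hFi (flipBit j ν))
    rw [← integral_mul_const, ofReal_integral_eq_lintegral_ofReal (hmi.mul_const _)
      (ae_of_all _ fun y => mul_nonneg (le_min (hF0 _ _) (hF0 _ _)) (by linarith)),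
      ← lintegral_add_left (hRm ν j)]
    refine lintegral_mono fun y => ?_
    rw [← ENNReal.ofReal_add (mul_nonneg (hF0 _ _) (hψ0 _)) (mul_nonneg (hF0 _ _) (hψ0 _))]
    refine ENNReal.ofReal_le_ofReal (min_mul_le_add (hF0 _ _) (hF0 _ _) (hψ0 _) (hψ0 _) ?_)
    -- The two neighbouring vertices place this coordinate at `1/k + δ` and `1/k - δ`, in an order
    -- given by the bit, so no estimate is good for both.
    have h := hψ (phat y (e (j, true)) - 1 / k)
    rw [hp, perturbation_apply, perturbation_apply]
    simp only [flipBit, Function.update_self, bitSign_not]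
    cases ν j <;> simp only [bitSign] <;> norm_num <;> norm_num at h <;> ring_nf at h ⊢ <;> linarith
  -- The main terms give `2m/3 ≥ 2k/9`, and the contraction inequality with `hnδ` limits the total
  -- correction to `k/9`.
  have hsumM : ∀ ν, (k : ℝ) / 9 ≤ ∑ j, M ν j := fun ν => by
    have h1 : ∀ j, 2 / 3 - n / 3 * ∫ y, (f ν y - f (flipBit j ν) y) ^ 2 ∂μ ≤ M ν j := fun j =>
      le_integral_min_prod n μ (hfm ν) (hfm _) (hfhalf ν) (hfhalf _) (hfK ν) (hfK _) (hf1 ν) (hf1 _)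
    have h2 : ∀ j y, (f ν y - f (flipBit j ν) y) ^ 2 =
        4 * δ ^ 2 * (q (e (j, true)) y - q (e (j, false)) y) ^ 2 := fun j y => by
      rw [hf]
      dsimp only
      rw [sum_perturbation_mul_sub_flipBit e δ ν hk (hqk y) j, mul_pow, mul_pow, ← sq_abs (bitSign _),
        abs_bitSign]
      ring
    have hdi : ∀ j, Integrable (fun y => (q (e (j, true)) y - q (e (j, false)) y) ^ 2) μ :=
      fun j => Integrable.of_bound
        (((hqm _).sub (hqm _)).pow_const 2).aestronglyMeasurable ((k : ℝ) ^ 2) <| ae_of_all _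
        fun y => by
          rw [Real.norm_of_nonneg (sq_nonneg _), ← sq_abs]
          have : |q (e (j, true)) y - q (e (j, false)) y| ≤ k := abs_le.2
            ⟨by linarith [hq0 (e (j, true)) y, hqle (e (j, false)) y],
              by linarith [hq0 (e (j, false)) y, hqle (e (j, true)) y]⟩
          gcongr
    have h3 : ∑ j, ∫ y, (q (e (j, true)) y - q (e (j, false)) y) ^ 2 ∂μ ≤
        k * (Real.exp ε - 1) ^ 2 / Real.exp ε := by
      rw [← integral_finsetSum _ fun j _ => hdi j]
      calc _ ≤ ∫ _y, (k : ℝ) * (Real.exp ε - 1) ^ 2 / Real.exp ε ∂μ :=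
            integral_mono (integrable_finsetSum _ fun j _ => hdi j) (integrable_const _) fun y =>
              sum_sq_sub_le hk (Real.exp_pos ε) (fun i => hq0 i y) (fun i j => hqe i j y) (hqk y) e
        _ = _ := by simp
    have h4 := Finset.sum_le_sum fun j (_ : j ∈ Finset.univ) => h1 j
    simp_rw [h2, integral_const_mul] at h4
    rw [Finset.sum_sub_distrib, ← Finset.mul_sum, ← Finset.mul_sum, Finset.sum_const,
      Finset.card_univ, Fintype.card_fin, nsmul_eq_mul] at h4
    have h5 : (n : ℝ) / 3 * (4 * δ ^ 2 * ∑ j, ∫ y, (q (e (j, true)) y - q (e (j, false)) y) ^ 2 ∂μ) ≤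
        k / 9 := by
      calc _ ≤ (n : ℝ) / 3 * (4 * δ ^ 2 * (k * (Real.exp ε - 1) ^ 2 / Real.exp ε)) := by gcongr
        _ = k / 9 * ((12 * n * δ ^ 2 * (Real.exp ε - 1) ^ 2) / Real.exp ε) := by ring
        _ ≤ k / 9 * 1 := by
          gcongr
          exact (div_le_one (Real.exp_pos ε)).2 hnδ
        _ = k / 9 := mul_one _
    have hm' : (k : ℝ) ≤ 3 * m := by exact_mod_cast hm
    linarith
  have hfinal := assouad_average (B := ENNReal.ofReal (2 * (τ * k / 9))) hRW fun ν => by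
    calc ENNReal.ofReal (2 * (τ * k / 9)) ≤ ENNReal.ofReal (∑ j, M ν j * (2 * τ)) := by
          rw [← Finset.sum_mul]
          refine ENNReal.ofReal_le_ofReal ?_
          nlinarith [hsumM ν]
      _ = ∑ j, ENNReal.ofReal (M ν j * (2 * τ)) :=
          ENNReal.ofReal_sum_of_nonneg fun j _ => mul_nonneg (hM0 ν j) (by linarith)
      _ ≤ _ := Finset.sum_le_sum fun j _ => hRM ν j
  rw [ENNReal.ofReal_mul (by norm_num), ENNReal.ofReal_ofNat] at hfinal
  exact (ENNReal.mul_le_mul_iff_right (by norm_num) (by norm_num)).1 hfinal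

/-- The pairs `{2 j, 2 j + 1}` of `Fin k`, as an embedding. -/
def pairEmbedding (k : ℕ) : Fin (k / 2) × Bool ↪ Fin k where
  toFun z := ⟨if z.2 then 2 * z.1 else 2 * z.1 + 1, by have := z.1.2; split_ifs <;> omega⟩
  inj' := by
    rintro ⟨⟨a, ha⟩, b⟩ ⟨⟨c, hc⟩, d⟩ h
    simp only [Fin.mk.injEq] at h
    cases b <;> cases d <;> simp at h ⊢ <;> omega

theorem le_privateMinimaxRisk {k n : ℕ} {ε δ τ : ℝ} (hε : 0 ≤ ε) (hk : 2 ≤ k) (hδ : 0 ≤ δ)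
    (hkδ : δ ≤ 1 / (2 * k)) (hnδ : 12 * n * δ ^ 2 * (Real.exp ε - 1) ^ 2 ≤ Real.exp ε)
    (hτ : 0 ≤ τ) {ψ : ℝ → ℝ} (hψ0 : ∀ x, 0 ≤ ψ x) (hψm : Measurable ψ)
    (hψ : ∀ x, 2 * τ ≤ ψ (x - δ) + ψ (x + δ)) :
    ENNReal.ofReal (τ * k / 9) ≤
      privateMinimaxRisk.{u} ε k n (fun v p => ∑ i, ψ (v i - p i)) :=
  le_iInf fun _Y => le_iInf fun _ => le_iInf fun _Q => le_iInf fun hQ => le_iInf fun _phat =>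
    -- The inequality `k ≤ 3 * (k / 2)` holds for all `k ≥ 2`, with equality at `k = 3`.
    le_iInf fun hphat => hQ.le_worstCaseRisk hε (by omega) (pairEmbedding k) (by omega) hδ hkδ hnδ
      hτ hψ0 hψm hψ hphat

/-! ### Invariance of the risk under relabelling of the output space -/

section Map

variable {k : ℕ} {Y : Type*} {Z : Type*} [MeasurableSpace Y] [MeasurableSpace Z]

theorem IsLDP.map {ε : ℝ} {Q : Kernel (Fin k) Y} (hQ : IsLDP ε Q) {g : Y → Z}
    (hg : Measurable g) : IsLDP ε (Q.map g) := by
  have := hQ.1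
  refine ⟨Kernel.IsMarkovKernel.map Q hg, fun x x' S hS => ?_⟩
  rw [Kernel.map_apply' Q hg x hS, Kernel.map_apply' Q hg x' hS]
  exact hQ.2 x x' _ (hg hS)

theorem marginal_map (Q : Kernel (Fin k) Y) {g : Y → Z} (hg : Measurable g) (p : Fin k → ℝ) :
    marginal (Q.map g) p = (marginal Q p).map g := by
  ext s hs
  rw [Measure.map_apply hg hs]
  simp only [marginal, Measure.finsetSum_apply, Measure.smul_apply]
  exact Finset.sum_congr rfl fun i _ => by rw [Kernel.map_apply' Q hg i hs]

theorem isProbabilityMeasure_marginal (Q : Kernel (Fin k) Y) [IsMarkovKernel Q] {p : Fin k → ℝ}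
    (hp : p ∈ stdSimplex ℝ (Fin k)) : IsProbabilityMeasure (marginal Q p) := ⟨by
  simp only [marginal, Measure.finsetSum_apply, Measure.smul_apply, measure_univ, smul_eq_mul,
    mul_one]
  rw [← ENNReal.ofReal_sum_of_nonneg fun i _ => hp.1 i, hp.2, ENNReal.ofReal_one]⟩

/-- A left inverse `h` of the relabelling turns any estimator on `Y` into one on `Z` with the same
risk. -/
theorem minimaxRisk_map_le (n : ℕ) {ℓ : Loss k} (hℓ : ∀ p, Measurable fun v => ℓ v p)
    (Q : Kernel (Fin k) Y) [IsMarkovKernel Q] {g : Y → Z} {h : Z → Y} (hg : Measurable g)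
    (hh : Measurable h) (hgh : ∀ y, h (g y) = y) :
    minimaxRisk n ℓ (Q.map g) ≤ minimaxRisk n ℓ Q := by
  refine le_iInf₂ fun phat hphat => ?_
  have hhn : Measurable fun (z : Fin n → Z) j => h (z j) :=
    measurable_pi_lambda _ fun j => hh.comp (measurable_pi_apply j)
  have hgn : Measurable fun (y : Fin n → Y) j => g (y j) :=
    measurable_pi_lambda _ fun j => hg.comp (measurable_pi_apply j)
  refine iInf₂_le_of_le (fun z => phat fun j => h (z j)) (hphat.comp hhn) ?_
  refine iSup₂_mono fun p hp => le_of_eq ?_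
  have := isProbabilityMeasure_marginal Q hp
  rw [risk, risk, marginal_map Q hg]
  have : IsProbabilityMeasure ((marginal Q p).map g) :=
    Measure.isProbabilityMeasure_map hg.aemeasurable
  rw [← Measure.pi_map_pi (μ := fun _ : Fin n => marginal Q p) (f := fun _ => g)
    fun _ => hg.aemeasurable,
    lintegral_map (f := fun z => ENNReal.ofReal (ℓ (phat fun j => h (z j)) p))
      (((hℓ p).comp (hphat.comp hhn)).ennreal_ofReal) hgn]
  simp only [hgh]

end Map

/-- The infimum runs over output spaces in universe `u`, whereas `Y` lives in `Type`; relabelling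
through `ULift` bridges the two. -/
theorem privateMinimaxRisk_le_minimaxRisk {k : ℕ} (n : ℕ) {ε : ℝ} {ℓ : Loss k}
    (hℓ : ∀ p, Measurable fun v => ℓ v p) {Y : Type} [MeasurableSpace Y] {Q : Kernel (Fin k) Y}
    (hQ : IsLDP ε Q) : privateMinimaxRisk.{u} ε k n ℓ ≤ minimaxRisk n ℓ Q := by
  have := hQ.1
  calc privateMinimaxRisk.{u} ε k n ℓ
      ≤ minimaxRisk n ℓ (Q.map (ULift.up : Y → ULift.{u} Y)) :=
        iInf_le_of_le (ULift.{u} Y) <| iInf_le_of_le inferInstance <|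
          iInf₂_le _ (hQ.map measurable_up)
    _ ≤ minimaxRisk n ℓ Q := minimaxRisk_map_le n hℓ Q measurable_up measurable_down fun _ => rfl

/-! ### The subset mechanism -/

instance (k d : ℕ) : DiscreteMeasurableSpace (SubsetAlphabet k d) := ⟨fun _ => trivial⟩

theorem card_filter_subset_subsetAlphabet {k d : ℕ} (t : Finset (Fin k)) (ht : t.card ≤ d) :
    (Finset.univ.filter fun y : SubsetAlphabet k d => t ⊆ y.1).card =
      (k - t.card).choose (d - t.card) := by
  have h := Finset.card_filter_powersetCard_subset t Finset.univ d (Finset.subset_univ t) ht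
  rw [Finset.card_univ, Fintype.card_fin] at h
  rw [← h]
  refine Finset.card_bij (fun y _ => y.1) ?_ ?_ ?_
  · intro y hy
    simpa [Finset.mem_powersetCard, y.2] using hy
  · intro y _ z _ h
    exact Subtype.ext h
  · intro y hy
    rw [Finset.mem_filter, Finset.mem_powersetCard] at hy
    exact ⟨⟨y, hy.1.2⟩, Finset.mem_filter.2 ⟨Finset.mem_univ _, hy.2⟩, rfl⟩

/-- The indicator of `y_i = 1`. -/
noncomputable def coord {k d : ℕ} (i : Fin k) (y : SubsetAlphabet k d) : ℝ :=
  if i ∈ y.1 then 1 else 0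

theorem sum_coord {k d : ℕ} (y : SubsetAlphabet k d) : ∑ i, coord i y = d := by
  simp only [coord]
  rw [Finset.sum_boole, Finset.filter_mem_eq_inter, Finset.univ_inter, y.2]

theorem sum_coord_alphabet {k d : ℕ} (hd : 1 ≤ d) (i : Fin k) :
    ∑ y : SubsetAlphabet k d, coord i y = (k - 1).choose (d - 1) := by
  have h := card_filter_subset_subsetAlphabet (k := k) (d := d) {i} (by simpa using hd)
  simp only [Finset.singleton_subset_iff, Finset.card_singleton] at h
  simp only [coord]
  rw [Finset.sum_boole, h]

theorem sum_coord_mul_coord {k d : ℕ} (hd : 1 ≤ d) {i j : Fin k} (hij : i ≠ j) :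
    ((k : ℝ) - 1) * ∑ y : SubsetAlphabet k d, coord i y * coord j y =
      ((d : ℝ) - 1) * (k - 1).choose (d - 1) := by
  have hk : 2 ≤ k := by
    have := i.2
    have := j.2
    have : (i : ℕ) ≠ j := fun h => hij (Fin.ext h)
    omega
  have hs : ∑ y : SubsetAlphabet k d, coord i y * coord j y =
      (Finset.univ.filter fun y : SubsetAlphabet k d => {i, j} ⊆ y.1).card := by
    rw [← Finset.sum_boole]
    refine Finset.sum_congr rfl fun y _ => ?_
    simp only [coord, Finset.insert_subset_iff, Finset.singleton_subset_iff, ite_and]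
    split_ifs <;> simp
  have hc : ({i, j} : Finset (Fin k)).card = 2 := Finset.card_pair hij
  rw [hs]
  rcases Nat.lt_or_ge d 2 with h | h
  -- For `d = 1` no output contains two symbols, but truncated subtraction would make the binomial
  -- count equal to `1`; hence the separate case.
  · have hd1 : d = 1 := by omega
    subst hd1
    rw [Finset.card_eq_zero.2]
    · simp
    · refine Finset.filter_eq_empty_iff.2 fun y _ hy => ?_
      have := Finset.card_le_card hy
      rw [hc, y.2] at this
      omega
  · rw [card_filter_subset_subsetAlphabet _ (hc ▸ h), hc]
    obtain ⟨k, rfl⟩ := Nat.exists_eq_add_of_le hk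
    obtain ⟨d, rfl⟩ := Nat.exists_eq_add_of_le h
    have := Nat.add_one_mul_choose_eq k d
    rw [show 2 + k - 2 = k by omega, show 2 + d - 2 = d by omega, show 2 + k - 1 = k + 1 by omega,
      show 2 + d - 1 = d + 1 by omega]
    have h' : ((k : ℝ) + 1) * k.choose d = (k + 1).choose (d + 1) * (d + 1) := by
      exact_mod_cast this
    push_cast
    linarith

theorem subsetProb_eq {k d : ℕ} (ε : ℝ) (i : Fin k) (y : SubsetAlphabet k d) :
    subsetProb k d ε i y = (1 + (Real.exp ε - 1) * coord i y) /
      (((k - 1).choose (d - 1) : ℝ) * Real.exp ε + ((k - 1).choose d : ℝ)) := by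
  rw [subsetProb, coord]
  congr 1
  split_ifs <;> ring

section Scheme

variable {k d : ℕ} {ε : ℝ}

theorem choose_pred_pos (hd : 1 ≤ d) (hdk : d < k) : (0 : ℝ) < (k - 1).choose (d - 1) := by
  exact_mod_cast Nat.choose_pos (by omega)

theorem choose_pred_mul (hd : 1 ≤ d) (hdk : d < k) :
    ((k - 1).choose d : ℝ) * d = (k - 1).choose (d - 1) * (k - d) := by
  have := Nat.choose_succ_right_eq (k - 1) (d - 1)
  rw [show d - 1 + 1 = d by omega, show k - 1 - (d - 1) = k - d by omega] at this
  have h : ((k - 1).choose d * d : ℝ) = (k - 1).choose (d - 1) * ((k - d : ℕ) : ℝ) := by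
    exact_mod_cast this
  rwa [Nat.cast_sub hdk.le] at h

theorem normalizer_pos (hd : 1 ≤ d) (hdk : d < k) :
    (0 : ℝ) < (k - 1).choose (d - 1) * Real.exp ε + (k - 1).choose d := by
  have := mul_pos (choose_pred_pos hd hdk) (Real.exp_pos ε)
  positivity

theorem subsetProb_nonneg (i : Fin k) (y : SubsetAlphabet k d) : 0 ≤ subsetProb k d ε i y := by
  rw [subsetProb]
  have := Real.exp_pos ε
  split_ifs <;> positivity

theorem card_subsetAlphabet (hd : 1 ≤ d) (hdk : d < k) :
    (Fintype.card (SubsetAlphabet k d) : ℝ) = (k - 1).choose (d - 1) + (k - 1).choose d := by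
  have h := card_filter_subset_subsetAlphabet (k := k) (d := d) ∅ (by simp)
  simp only [Finset.empty_subset, Finset.filter_true, Finset.card_univ, Finset.card_empty,
    Nat.sub_zero] at h
  rw [h]
  obtain ⟨d, rfl⟩ := Nat.exists_eq_add_of_le' hd
  obtain ⟨k, rfl⟩ := Nat.exists_eq_add_of_le' (show 1 ≤ k by omega)
  simp [Nat.choose_succ_succ]

theorem sum_subsetProb (hd : 1 ≤ d) (hdk : d < k) (i : Fin k) :
    ∑ y, subsetProb k d ε i y = 1 := by
  simp_rw [subsetProb_eq]
  rw [← Finset.sum_div, div_eq_one_iff_eq (normalizer_pos hd hdk).ne', Finset.sum_add_distrib,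
    ← Finset.mul_sum, sum_coord_alphabet hd, Finset.sum_const, Finset.card_univ, nsmul_eq_mul,
    card_subsetAlphabet hd hdk]
  ring

theorem subsetScheme_apply (i : Fin k) :
    subsetScheme k d ε i = ∑ y, ENNReal.ofReal (subsetProb k d ε i y) • Measure.dirac y := rfl

theorem isLDP_subsetScheme (hε : 0 ≤ ε) (hd : 1 ≤ d) (hdk : d < k) :
    IsLDP ε (subsetScheme k d ε) := by
  refine ⟨⟨fun i => ⟨?_⟩⟩, fun i j S _ => ?_⟩
  · simp only [subsetScheme_apply, Measure.finsetSum_apply, Measure.smul_apply, measure_univ,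
      smul_eq_mul, mul_one]
    rw [← ENNReal.ofReal_sum_of_nonneg fun y _ => subsetProb_nonneg i y, sum_subsetProb hd hdk,
      ENNReal.ofReal_one]
  · simp only [subsetScheme_apply, Measure.finsetSum_apply, Measure.smul_apply, smul_eq_mul]
    rw [Finset.mul_sum]
    refine Finset.sum_le_sum fun y _ => ?_
    rw [← mul_assoc, ← ENNReal.ofReal_mul (Real.exp_pos ε).le]
    gcongr
    rw [subsetProb, subsetProb, ← mul_div_assoc]
    have h1 := Real.one_le_exp hε
    refine div_le_div_of_nonneg_right ?_ (normalizer_pos hd hdk).le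
    split_ifs <;> nlinarith

theorem integral_marginal_subsetScheme {p : Fin k → ℝ} (hp : ∀ i, 0 ≤ p i)
    (g : SubsetAlphabet k d → ℝ) :
    ∫ y, g y ∂(marginal (subsetScheme k d ε) p) = ∑ i, p i * ∑ y, subsetProb k d ε i y * g y := by
  have hi : ∀ i, Integrable g (subsetScheme k d ε i) := fun i => by
    rw [subsetScheme_apply]
    exact integrable_finsetSum_measure.2 fun y _ =>
      (Integrable.of_finite).smul_measure ENNReal.ofReal_ne_top
  rw [marginal, integral_finsetSum_measure fun i _ => (hi i).smul_measure ENNReal.ofReal_ne_top]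
  refine Finset.sum_congr rfl fun i _ => ?_
  rw [integral_smul_measure, ENNReal.toReal_ofReal (hp i), smul_eq_mul, subsetScheme_apply,
    integral_finsetSum_measure fun y _ => (Integrable.of_finite).smul_measure ENNReal.ofReal_ne_top]
  congr 1
  refine Finset.sum_congr rfl fun y _ => ?_
  rw [integral_smul_measure, ENNReal.toReal_ofReal (subsetProb_nonneg i y), integral_dirac,
    smul_eq_mul]

/-- The slope of the empirical estimator. -/
noncomputable def empSlope (k d : ℕ) (ε : ℝ) : ℝ :=
  (((k : ℝ) - 1) * Real.exp ε + ((k : ℝ) - 1) * ((k : ℝ) - d) / d) /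
    (((k : ℝ) - d) * (Real.exp ε - 1))

/-- The offset of the empirical estimator. -/
noncomputable def empOffset (k d : ℕ) (ε : ℝ) : ℝ :=
  (((d : ℝ) - 1) * Real.exp ε + k - d) / (((k : ℝ) - d) * (Real.exp ε - 1))

/-- The probability that coordinate `j` is set takes one value for `i = j` and another for `i ≠ j`.
Slope and offset define the affine map sending these to `1` and `0`, which makes the estimator
unbiased. -/
theorem empSlope_mul_sum_subsetProb_coord (hε : 0 < ε) (hd : 1 ≤ d) (hdk : d < k) (i j : Fin k) :
    empSlope k d ε * ∑ y, subsetProb k d ε i y * coord j y =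
      (if i = j then 1 else 0) + empOffset k d ε := by
  have hk1 : (0 : ℝ) < (k : ℝ) - 1 := by
    have : (2 : ℝ) ≤ k := by exact_mod_cast (by omega : 2 ≤ k)
    linarith
  have hd0 : (0 : ℝ) < d := by exact_mod_cast hd
  have hkd : (0 : ℝ) < (k : ℝ) - d := sub_pos.2 (by exact_mod_cast hdk)
  have hE : 0 < Real.exp ε - 1 := sub_pos.2 (Real.one_lt_exp_iff.2 hε)
  have hEp := Real.exp_pos ε
  have hB := choose_pred_pos hd hdk
  have hC : ((k - 1).choose d : ℝ) = (k - 1).choose (d - 1) * (k - d) / d := by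
    rw [eq_div_iff hd0.ne', choose_pred_mul hd hdk]
  have hsum : ∑ y, subsetProb k d ε i y * coord j y =
      ((k - 1).choose (d - 1) + (Real.exp ε - 1) *
        ∑ y : SubsetAlphabet k d, coord i y * coord j y) /
      (((k - 1).choose (d - 1) : ℝ) * Real.exp ε + ((k - 1).choose d : ℝ)) := by
    simp_rw [subsetProb_eq, div_mul_eq_mul_div]
    rw [← Finset.sum_div, ← sum_coord_alphabet hd j, Finset.mul_sum, ← Finset.sum_add_distrib]
    congr 1
    refine Finset.sum_congr rfl fun y _ => by ring
  rw [hsum, hC, empSlope, empOffset]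
  set B : ℝ := ((k - 1).choose (d - 1) : ℝ) with hBdef
  have hden : (0 : ℝ) < d * Real.exp ε + (k - d) := by positivity
  by_cases hij : i = j
  · subst hij
    have hself : ∑ y : SubsetAlphabet k d, coord i y * coord i y = B := by
      rw [hBdef, ← sum_coord_alphabet hd i]
      refine Finset.sum_congr rfl fun y _ => ?_
      rw [coord]; split_ifs <;> simp
    rw [hself, if_pos rfl]
    field_simp
    ring
  · have hpair : ∑ y : SubsetAlphabet k d, coord i y * coord j y = (d - 1) * B / (k - 1) := by
      rw [eq_div_iff hk1.ne', mul_comm, sum_coord_mul_coord hd hij]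
    rw [hpair, if_neg hij]
    field_simp
    ring

end Scheme

/-! ### The empirical estimator -/

section Empirical

variable {k d n : ℕ} {ε : ℝ} {p : Fin k → ℝ}

theorem empiricalEstimator_eq (y : Fin n → SubsetAlphabet k d) (i : Fin k) :
    empiricalEstimator k d n ε y i =
      empSlope k d ε / n * (∑ j, fun y : Fin n → SubsetAlphabet k d => coord i (y j)) y -
        empOffset k d ε := by
  have : (count y i : ℝ) = ∑ j, coord i (y j) := by
    simp only [coord, count]
    rw [Finset.sum_boole]
  rw [Finset.sum_apply, ← this, empiricalEstimator, empSlope, empOffset]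
  ring

theorem empSlope_mul_integral_coord (hε : 0 < ε) (hd : 1 ≤ d) (hdk : d < k)
    (hp : p ∈ stdSimplex ℝ (Fin k)) (i : Fin k) :
    empSlope k d ε * ∫ y, coord i y ∂(marginal (subsetScheme k d ε) p) =
      p i + empOffset k d ε := by
  rw [integral_marginal_subsetScheme hp.1, Finset.mul_sum]
  calc _ = ∑ j, p j * ((if j = i then 1 else 0) + empOffset k d ε) :=
        Finset.sum_congr rfl fun j _ => by
          rw [← empSlope_mul_sum_subsetProb_coord hε hd hdk]; ring
    _ = _ := by simp [mul_add, Finset.sum_add_distrib, ← Finset.sum_mul, hp.2]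

theorem integral_sq_empiricalEstimator_sub_le (hε : 0 < ε) (hd : 1 ≤ d) (hdk : d < k) (hn : 0 < n)
    (hp : p ∈ stdSimplex ℝ (Fin k)) (i : Fin k) :
    ∫ y, (empiricalEstimator k d n ε y i - p i) ^ 2
        ∂(Measure.pi fun _ : Fin n => marginal (subsetScheme k d ε) p) ≤
      empSlope k d ε ^ 2 / n * ∫ y, coord i y ∂(marginal (subsetScheme k d ε) p) := by
  have := (isLDP_subsetScheme hε.le hd hdk).1
  have := isProbabilityMeasure_marginal (subsetScheme k d ε) hp
  set m := marginal (subsetScheme k d ε) p with hm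
  set q := ∫ y, coord i y ∂m with hq
  have hn' : (n : ℝ) ≠ 0 := by exact_mod_cast hn.ne'
  have haq := empSlope_mul_integral_coord hε hd hdk hp i
  rw [← hm, ← hq] at haq
  set S : (Fin n → SubsetAlphabet k d) → ℝ := ∑ j, fun y => coord i (y j) with hS
  have hES : ∫ y, S y ∂(Measure.pi fun _ : Fin n => m) = n * q := by
    simp only [hS, Finset.sum_apply]
    rw [integral_finsetSum _ fun j _ => Integrable.of_finite]
    calc _ = ∑ _j : Fin n, q := Finset.sum_congr rfl fun j _ =>
          integral_comp_eval (μ := fun _ : Fin n => m) (i := j) (f := coord i)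
            (Measurable.of_discrete).aestronglyMeasurable
      _ = _ := by simp
  have hVS : ∫ y, (S y - n * q) ^ 2 ∂(Measure.pi fun _ : Fin n => m) ≤ n * q := by
    rw [← hES, ← variance_eq_integral (Measurable.of_discrete).aemeasurable, hS,
      variance_sum_pi (μ := fun _ : Fin n => m) (X := fun _ => coord i) fun _ => MemLp.of_discrete,
      Finset.sum_const, Finset.card_univ, Fintype.card_fin, nsmul_eq_mul, ← hS, hES]
    gcongr
    -- A `0`-`1` variable equals its square, so its variance is at most its mean.
    refine (variance_le_expectation_sq (Measurable.of_discrete).aestronglyMeasurable).trans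
      (le_of_eq ?_)
    refine integral_congr_ae (ae_of_all _ fun y => ?_)
    simp only [coord, Pi.pow_apply]
    split_ifs <;> simp
  calc _ = ∫ y, (empSlope k d ε / n) ^ 2 * (S y - n * q) ^ 2 ∂(Measure.pi fun _ : Fin n => m) := by
        refine integral_congr_ae (ae_of_all _ fun y => ?_)
        simp only [empiricalEstimator_eq, ← hS]
        rw [← mul_pow, mul_sub, show empSlope k d ε / n * (n * q) = p i + empOffset k d ε by
          rw [← haq]; field_simp]
        ring
    _ = (empSlope k d ε / n) ^ 2 * ∫ y, (S y - n * q) ^ 2 ∂(Measure.pi fun _ : Fin n => m) :=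
        integral_const_mul _ _
    _ ≤ (empSlope k d ε / n) ^ 2 * (n * q) := by gcongr
    _ = empSlope k d ε ^ 2 / n * q := by field_simp

theorem integral_sum_sq_empiricalEstimator_sub_le (hε : 0 < ε) (hd : 1 ≤ d) (hdk : d < k)
    (hn : 0 < n) (hp : p ∈ stdSimplex ℝ (Fin k)) :
    ∫ y, ∑ i, (empiricalEstimator k d n ε y i - p i) ^ 2
        ∂(Measure.pi fun _ : Fin n => marginal (subsetScheme k d ε) p) ≤
      empSlope k d ε ^ 2 * d / n := by
  have := (isLDP_subsetScheme hε.le hd hdk).1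
  have := isProbabilityMeasure_marginal (subsetScheme k d ε) hp
  rw [integral_finsetSum _ fun i _ => Integrable.of_finite]
  calc _ ≤ ∑ i, empSlope k d ε ^ 2 / n * ∫ y, coord i y ∂(marginal (subsetScheme k d ε) p) :=
        Finset.sum_le_sum fun i _ => integral_sq_empiricalEstimator_sub_le hε hd hdk hn hp i
    _ = empSlope k d ε ^ 2 / n *
          ∫ y, ∑ i, coord i y ∂(marginal (subsetScheme k d ε) p) := by
        rw [integral_finsetSum _ fun i _ => Integrable.of_finite, Finset.mul_sum]
    _ = empSlope k d ε ^ 2 * d / n := by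
        simp only [sum_coord, integral_const, probReal_univ, smul_eq_mul]
        ring

theorem worstCaseRisk_lossL2Sq_empiricalEstimator_le (hε : 0 < ε) (hd : 1 ≤ d) (hdk : d < k)
    (hn : 0 < n) :
    worstCaseRisk n (lossL2Sq k) (subsetScheme k d ε) (empiricalEstimator k d n ε) ≤
      ENNReal.ofReal (empSlope k d ε ^ 2 * d / n) := by
  refine iSup₂_le fun p hp => ?_
  have := (isLDP_subsetScheme hε.le hd hdk).1
  have := isProbabilityMeasure_marginal (subsetScheme k d ε) hp
  simp only [risk, lossL2Sq]
  rw [← ofReal_integral_eq_lintegral_ofReal Integrable.of_finite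
    (ae_of_all _ fun y => Finset.sum_nonneg fun i _ => sq_nonneg _)]
  exact ENNReal.ofReal_le_ofReal (integral_sum_sq_empiricalEstimator_sub_le hε hd hdk hn hp)

/-- Young's inequality in each coordinate; the weight `t` stays free so that the two terms can be
balanced at the end. -/
theorem sum_abs_le_sum_sq (x : Fin k → ℝ) {t : ℝ} (ht : 0 < t) :
    ∑ i, |x i| ≤ (t * ∑ i, x i ^ 2 + k / t) / 2 := by
  calc ∑ i, |x i| ≤ ∑ i, (t * x i ^ 2 + 1 / t) / 2 := by
        refine Finset.sum_le_sum fun i _ => ?_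
        rw [← sq_abs]
        have h : 0 ≤ (t * |x i| - 1) ^ 2 / t := by positivity
        have h2 : (t * |x i| - 1) ^ 2 / t = t * |x i| ^ 2 - 2 * |x i| + 1 / t := by
          field_simp; ring
        linarith
    _ = _ := by
        rw [← Finset.sum_div, Finset.sum_add_distrib, ← Finset.mul_sum, Finset.sum_const,
          Finset.card_univ, Fintype.card_fin, nsmul_eq_mul, mul_one_div]

theorem worstCaseRisk_lossL1_empiricalEstimator_le (hε : 0 < ε) (hd : 1 ≤ d) (hdk : d < k)
    (hn : 0 < n) {t : ℝ} (ht : 0 < t) :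
    worstCaseRisk n (lossL1 k) (subsetScheme k d ε) (empiricalEstimator k d n ε) ≤
      ENNReal.ofReal ((t * (empSlope k d ε ^ 2 * d / n) + k / t) / 2) := by
  refine iSup₂_le fun p hp => ?_
  have := (isLDP_subsetScheme hε.le hd hdk).1
  have := isProbabilityMeasure_marginal (subsetScheme k d ε) hp
  simp only [risk, lossL1]
  rw [← ofReal_integral_eq_lintegral_ofReal Integrable.of_finite
    (ae_of_all _ fun y => Finset.sum_nonneg fun i _ => abs_nonneg _)]
  refine ENNReal.ofReal_le_ofReal ?_
  calc _ ≤ ∫ y, (t * ∑ i, (empiricalEstimator k d n ε y i - p i) ^ 2 + k / t) / 2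
          ∂(Measure.pi fun _ : Fin n => marginal (subsetScheme k d ε) p) :=
        integral_mono Integrable.of_finite Integrable.of_finite fun y => sum_abs_le_sum_sq _ ht
    _ = (t * (∫ y, ∑ i, (empiricalEstimator k d n ε y i - p i) ^ 2
          ∂(Measure.pi fun _ : Fin n => marginal (subsetScheme k d ε) p)) + k / t) / 2 := by
        rw [integral_div, integral_add Integrable.of_finite (integrable_const _),
          integral_const_mul]
        simp
    _ ≤ _ := by
        gcongr
        exact integral_sum_sq_empiricalEstimator_sub_le hε hd hdk hn hp

end Empirical

/-! ### The choice of the subset size -/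

section SubsetSize

variable {k : ℕ} {ε : ℝ}

theorem one_le_subsetSize (hk : 2 ≤ k) : 1 ≤ subsetSize k ε := by
  have : (0 : ℝ) < k := by exact_mod_cast (by omega : 0 < k)
  have := Real.exp_pos ε
  exact Nat.one_le_ceil_iff.2 (by positivity)

theorem two_mul_subsetSize_le (hε : 0 < ε) (hk : 2 ≤ k) : 2 * subsetSize k ε ≤ k + 1 := by
  have hk' : (0 : ℝ) < k := by exact_mod_cast (by omega : 0 < k)
  have hE := Real.one_lt_exp_iff.2 hε
  have h := Nat.ceil_lt_add_one (a := (k : ℝ) / (Real.exp ε + 1)) (by positivity)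
  have h2 : (k : ℝ) / (Real.exp ε + 1) < k / 2 := by
    gcongr; linarith
  have h3 : (2 * subsetSize k ε : ℝ) < k + 2 := by
    rw [subsetSize]; linarith
  have h4 : 2 * subsetSize k ε < k + 2 := by exact_mod_cast h3
  omega

theorem subsetSize_lt (hε : 0 < ε) (hk : 2 ≤ k) : subsetSize k ε < k := by
  have := two_mul_subsetSize_le hε hk
  omega

theorem empSlope_sq_mul_subsetSize_le {A : ℝ} (hε : 0 < ε) (hk : 2 ≤ k)
    (hA : Real.exp ε ≤ A * k) :
    empSlope k (subsetSize k ε) ε ^ 2 * subsetSize k ε ≤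
      16 * (1 + A) * (k * Real.exp ε / (Real.exp ε - 1) ^ 2) := by
  have hk' : (2 : ℝ) ≤ k := by exact_mod_cast hk
  have hE := Real.one_lt_exp_iff.2 hε
  have h2d : (2 * subsetSize k ε : ℝ) ≤ k + 1 := by exact_mod_cast two_mul_subsetSize_le hε hk
  have hd1 : (1 : ℝ) ≤ subsetSize k ε := by exact_mod_cast one_le_subsetSize hk
  have hlow : (k : ℝ) / (Real.exp ε + 1) ≤ subsetSize k ε := Nat.le_ceil _
  have hup : (subsetSize k ε : ℝ) < k / (Real.exp ε + 1) + 1 := Nat.ceil_lt_add_one (by positivity)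
  set E := Real.exp ε with hEdef
  set d : ℝ := (subsetSize k ε : ℝ) with hd
  have hs : 0 < E - 1 := by linarith
  have hkd : 0 < k - d := by linarith
  rw [div_le_iff₀ (by linarith)] at hlow
  -- Rounding up costs at most one extra `e^ε`, which `hA` absorbs; this is the only use of the
  -- regime `e^ε ≤ A k`.
  have hdE : d * E ≤ (1 + A) * k := by
    have h : (k : ℝ) / (E + 1) * E ≤ k := by
      rw [div_mul_eq_mul_div, div_le_iff₀ (by linarith)]
      nlinarith
    nlinarith
  -- The ceiling gives `(k - d) / d ≤ e^ε`, so the numerator is at most `2 (k - 1) e^ε`; then `2d ≤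
  -- k + 1` gives `k - 1 ≤ 2 (k - d)`.
  have hslope : empSlope k (subsetSize k ε) ε ≤ 4 * E / (E - 1) := by
    rw [empSlope, ← hEdef, ← hd, ← div_div, div_le_div_iff_of_pos_right hs, div_le_iff₀ hkd]
    have h1 : ((k : ℝ) - 1) * (k - d) / d ≤ (k - 1) * E := by
      rw [div_le_iff₀ (by linarith), mul_assoc]
      refine mul_le_mul_of_nonneg_left (by linarith) (by linarith)
    nlinarith
  have hslope0 : 0 ≤ empSlope k (subsetSize k ε) ε := by
    rw [empSlope, ← hEdef, ← hd]
    have : (0 : ℝ) ≤ (k : ℝ) - 1 := by linarith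
    positivity
  calc empSlope k (subsetSize k ε) ε ^ 2 * d ≤ (4 * E / (E - 1)) ^ 2 * d := by gcongr
    _ = 16 * (E / (E - 1) ^ 2) * (d * E) := by field_simp; norm_num
    _ ≤ 16 * (E / (E - 1) ^ 2) * ((1 + A) * k) := by gcongr
    _ = _ := by ring

end SubsetSize

/-! ### The rates -/

section Rates

variable {k n : ℕ} {ε : ℝ}

theorem rate_le_privateMinimaxRisk (hε : 0 < ε) (hk : 2 ≤ k) (hn : 0 < n)
    (hN : (k * √(Real.exp ε) / (2 * (Real.exp ε - 1))) ^ 2 ≤ n) :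
    ENNReal.ofReal (1 / 144 * rateL2Sq ε k n) ≤ privateMinimaxRisk.{u} ε k n (lossL2Sq k) ∧
      ENNReal.ofReal (1 / 144 * rateL1 ε k n) ≤ privateMinimaxRisk.{u} ε k n (lossL1 k) := by
  have hk' : (0 : ℝ) < k := by exact_mod_cast (by omega : 0 < k)
  have hn' : (0 : ℝ) < n := by exact_mod_cast hn
  have hs : 0 < Real.exp ε - 1 := sub_pos.2 (Real.one_lt_exp_iff.2 hε)
  have hE := Real.exp_pos ε
  have hsq : √(Real.exp ε) ^ 2 = Real.exp ε := Real.sq_sqrt hE.le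
  have hnsq : √(n : ℝ) ^ 2 = n := Real.sq_sqrt hn'.le
  have hsn : 0 < √(n : ℝ) := Real.sqrt_pos.2 hn'
  -- The factor `4` makes the left side of `hnδ` equal to `3/4 e^ε`; `hN` is exactly the condition
  -- `δ ≤ 1 / (2k)`.
  set δ : ℝ := √(Real.exp ε) / (4 * √n * (Real.exp ε - 1)) with hδ
  have hδ0 : 0 ≤ δ := by positivity
  have hδ2 : δ ^ 2 = Real.exp ε / (16 * n * (Real.exp ε - 1) ^ 2) := by
    rw [hδ, div_pow, mul_pow, mul_pow, hsq, hnsq]; norm_num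
  have hkδ : δ ≤ 1 / (2 * k) := by
    have h := Real.le_sqrt_of_sq_le hN
    rw [div_le_iff₀ (by positivity)] at h
    rw [hδ, div_le_div_iff₀ (by positivity) (by positivity)]
    linarith
  have hnδ : 12 * n * δ ^ 2 * (Real.exp ε - 1) ^ 2 ≤ Real.exp ε := by
    rw [hδ2]
    have : 12 * n * (Real.exp ε / (16 * n * (Real.exp ε - 1) ^ 2)) * (Real.exp ε - 1) ^ 2 =
        3 / 4 * Real.exp ε := by field_simp; norm_num
    linarith
  constructor
  · have h := le_privateMinimaxRisk.{u} (n := n) (τ := δ ^ 2) (ψ := fun x => x ^ 2) hε.le hk hδ0 hkδ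
      hnδ (sq_nonneg _) (fun x => sq_nonneg x) (by fun_prop) fun x => by nlinarith [sq_nonneg x]
    refine le_trans (le_of_eq (congrArg _ ?_)) h
    rw [hδ2, rateL2Sq]
    field_simp
    norm_num
  -- Even `τ = δ` would be admissible; `δ / 4` yields the same constant `1 / 144` as the squared
  -- loss.
  · have h := le_privateMinimaxRisk.{u} (n := n) (τ := δ / 4) (ψ := fun x => |x|) hε.le hk hδ0 hkδ
      hnδ (by positivity) (fun x => abs_nonneg x) (by fun_prop) fun x => by
        linarith [neg_abs_le (x - δ), le_abs_self (x + δ)]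
    refine le_trans (le_of_eq (congrArg _ ?_)) h
    rw [hδ, rateL1]
    field_simp
    norm_num

theorem worstCaseRisk_le_rate {A : ℝ} (hA : 0 < A) (hε : 0 < ε) (hk : 2 ≤ k) (hn : 0 < n)
    (hAk : Real.exp ε ≤ A * k) :
    worstCaseRisk n (lossL2Sq k) (subsetScheme k (subsetSize k ε) ε)
        (empiricalEstimator k (subsetSize k ε) n ε) ≤
          ENNReal.ofReal (16 * (1 + A) * rateL2Sq ε k n) ∧
      worstCaseRisk n (lossL1 k) (subsetScheme k (subsetSize k ε) ε)
        (empiricalEstimator k (subsetSize k ε) n ε) ≤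
          ENNReal.ofReal (16 * (1 + A) * rateL1 ε k n) := by
  have hd := one_le_subsetSize (ε := ε) hk
  have hdk := subsetSize_lt hε hk
  have hk' : (0 : ℝ) < k := by exact_mod_cast (by omega : 0 < k)
  have hn' : (0 : ℝ) < n := by exact_mod_cast hn
  have hs : 0 < Real.exp ε - 1 := sub_pos.2 (Real.one_lt_exp_iff.2 hε)
  have hE := Real.exp_pos ε
  have hsqE : 0 < √(Real.exp ε) := Real.sqrt_pos.2 hE
  have hsq : √(Real.exp ε) ^ 2 = Real.exp ε := Real.sq_sqrt hE.le
  have hnsq : √(n : ℝ) ^ 2 = n := Real.sq_sqrt hn'.le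
  have hsn : 0 < √(n : ℝ) := Real.sqrt_pos.2 hn'
  have hV : empSlope k (subsetSize k ε) ε ^ 2 * subsetSize k ε / n ≤
      16 * (1 + A) * rateL2Sq ε k n := by
    calc _ ≤ 16 * (1 + A) * (k * Real.exp ε / (Real.exp ε - 1) ^ 2) / n :=
          div_le_div_of_nonneg_right (empSlope_sq_mul_subsetSize_le hε hk hAk) hn'.le
      _ = _ := by rw [rateL2Sq]; field_simp
  refine ⟨(worstCaseRisk_lossL2Sq_empiricalEstimator_le hε hd hdk hn).trans
    (ENNReal.ofReal_le_ofReal hV), ?_⟩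
  -- This weight equalizes `t * rateL2Sq` and `k / t`, both being `rateL1`; the second term is
  -- absorbed since `1 ≤ 16 (1 + A)`.
  set t : ℝ := √n * (Real.exp ε - 1) / √(Real.exp ε) with ht
  have ht0 : 0 < t := by positivity
  refine (worstCaseRisk_lossL1_empiricalEstimator_le hε hd hdk hn ht0).trans
    (ENNReal.ofReal_le_ofReal ?_)
  have hr : 0 ≤ rateL1 ε k n := by rw [rateL1]; positivity
  have h1 : t * rateL2Sq ε k n = rateL1 ε k n := by
    have h : rateL2Sq ε k n = k * √(Real.exp ε) ^ 2 / (√n ^ 2 * (Real.exp ε - 1) ^ 2) := by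
      rw [hsq, hnsq, rateL2Sq]
    rw [h, ht, rateL1]
    field_simp
  have h2 : k / t = rateL1 ε k n := by
    rw [ht, rateL1]; field_simp
  have h3 := mul_le_mul_of_nonneg_left hV ht0.le
  rw [h2]
  have h4 : t * (16 * (1 + A) * rateL2Sq ε k n) = 16 * (1 + A) * rateL1 ε k n := by
    rw [← h1]; ring
  nlinarith

end Rates

theorem measurable_lossL2Sq {k : ℕ} (p : Fin k → ℝ) : Measurable fun v => lossL2Sq k v p := by
  unfold lossL2Sq; fun_prop

theorem measurable_lossL1 {k : ℕ} (p : Fin k → ℝ) : Measurable fun v => lossL1 k v p := by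
  unfold lossL1; fun_prop

end LDPEstimation

theorem mainTheorem3 (A : ℝ) (hA : 0 < A) :
    ∃ c C : ℝ, 0 < c ∧ 0 < C ∧
      ∀ (k : ℕ) (ε : ℝ), 2 ≤ k → 0 < ε → Real.exp ε ≤ A * k →
        LDPEstimation.IsLDP ε
            (LDPEstimation.subsetScheme k (LDPEstimation.subsetSize k ε) ε) ∧
        ∃ N : ℕ, ∀ n : ℕ, N ≤ n →
          (ENNReal.ofReal (c * LDPEstimation.rateL2Sq ε k n)
              ≤ LDPEstimation.privateMinimaxRisk.{u} ε k n (LDPEstimation.lossL2Sq k) ∧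
            LDPEstimation.privateMinimaxRisk.{u} ε k n (LDPEstimation.lossL2Sq k)
              ≤ LDPEstimation.minimaxRisk n (LDPEstimation.lossL2Sq k)
                  (LDPEstimation.subsetScheme k (LDPEstimation.subsetSize k ε) ε) ∧
            LDPEstimation.minimaxRisk n (LDPEstimation.lossL2Sq k)
                  (LDPEstimation.subsetScheme k (LDPEstimation.subsetSize k ε) ε)
              ≤ LDPEstimation.worstCaseRisk n (LDPEstimation.lossL2Sq k)
                  (LDPEstimation.subsetScheme k (LDPEstimation.subsetSize k ε) ε)
                  (LDPEstimation.empiricalEstimator k (LDPEstimation.subsetSize k ε) n ε) ∧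
            LDPEstimation.worstCaseRisk n (LDPEstimation.lossL2Sq k)
                  (LDPEstimation.subsetScheme k (LDPEstimation.subsetSize k ε) ε)
                  (LDPEstimation.empiricalEstimator k (LDPEstimation.subsetSize k ε) n ε)
              ≤ ENNReal.ofReal (C * LDPEstimation.rateL2Sq ε k n)) ∧
          (ENNReal.ofReal (c * LDPEstimation.rateL1 ε k n)
              ≤ LDPEstimation.privateMinimaxRisk.{u} ε k n (LDPEstimation.lossL1 k) ∧
            LDPEstimation.privateMinimaxRisk.{u} ε k n (LDPEstimation.lossL1 k)
              ≤ LDPEstimation.minimaxRisk n (LDPEstimation.lossL1 k)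
                  (LDPEstimation.subsetScheme k (LDPEstimation.subsetSize k ε) ε) ∧
            LDPEstimation.minimaxRisk n (LDPEstimation.lossL1 k)
                  (LDPEstimation.subsetScheme k (LDPEstimation.subsetSize k ε) ε)
              ≤ LDPEstimation.worstCaseRisk n (LDPEstimation.lossL1 k)
                  (LDPEstimation.subsetScheme k (LDPEstimation.subsetSize k ε) ε)
                  (LDPEstimation.empiricalEstimator k (LDPEstimation.subsetSize k ε) n ε) ∧
            LDPEstimation.worstCaseRisk n (LDPEstimation.lossL1 k)
                  (LDPEstimation.subsetScheme k (LDPEstimation.subsetSize k ε) ε)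
                  (LDPEstimation.empiricalEstimator k (LDPEstimation.subsetSize k ε) n ε)
              ≤ ENNReal.ofReal (C * LDPEstimation.rateL1 ε k n)) := by
  refine ⟨1 / 144, 16 * (1 + A), by norm_num, by positivity, fun k ε hk hε hAk => ?_⟩
  have hLDP := LDPEstimation.isLDP_subsetScheme hε.le (LDPEstimation.one_le_subsetSize (ε := ε) hk)
    (LDPEstimation.subsetSize_lt hε hk)
  -- The `+ 1` gives `0 < n` directly.
  refine ⟨hLDP, ⌈(k * √(Real.exp ε) / (2 * (Real.exp ε - 1))) ^ 2⌉₊ + 1, fun n hn => ?_⟩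
  have hn0 : 0 < n := by omega
  have hN : (k * √(Real.exp ε) / (2 * (Real.exp ε - 1))) ^ 2 ≤ n :=
    (Nat.le_ceil _).trans (by exact_mod_cast (by omega))
  have hlow := LDPEstimation.rate_le_privateMinimaxRisk.{u} hε hk hn0 hN
  have hup := LDPEstimation.worstCaseRisk_le_rate hA hε hk hn0 hAk
  exact ⟨⟨hlow.1,
      LDPEstimation.privateMinimaxRisk_le_minimaxRisk n LDPEstimation.measurable_lossL2Sq hLDP,
      iInf₂_le _ Measurable.of_discrete, hup.1⟩,
    hlow.2, LDPEstimation.privateMinimaxRisk_le_minimaxRisk n LDPEstimation.measurable_lossL1 hLDP,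
    iInf₂_le _ Measurable.of_discrete, hup.2⟩
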